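/- A (finite, simple) hypergraph $H=(V,E)$ has a finite vertex set $V$ and edge set $E\subseteq 2^V$; let $R(H)=\{|e|: e\in E\}$. A hypergraph $H$ is contained in $G$ if there is an injective map $V(H)\to V(G)$ sending every edge of $H$ to an edge of $G$. For a hypergraph $G$ on $n$ vertices let $h_n(G)=\sum_{e\in E(G)}\binom{n}{|e|}^{-1}$, let $\pi_n(H)$ be the maximum of $h_n(G)$ over all hypergraphs $G$ on $n$ vertices with $R(G)\subseteq R(H)$ that do not contain $H$, and let $\pi(H)=\lim_{n\to\infty}\pi_n(H)$. Call $H$ degenerate if $\pi(H)=|R(H)|-1$. For a finite set $R$ of positive integers, the chain $C^R$ is the hypergraph on $\{1,\dots,\max R\}$ with edges $\{1,\dots,k\}$, $k\in R$. A blow-up of a hypergraph replaces each vertex $i$ by a finite nonempty set $V_i$ (the $V_i$ pairwise disjoint) and each edge $F$ by all sets consisting of exactly one vertex from each $V_i$, $i\in F$. **Theorem.** Let $R$ be a finite set of positive integers with $|R|\ge 2$ and $R\neq\{1,2\}$. Then there is a non-trivial degenerate $R$-graph, that is, a degenerate hypergraph $H$ with $R(H)=R$ that is not contained in any blow-up of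 the chain $C^R$. -/

import Mathlib

open Filter Topology

namespace Hypergraph

variable {α β : Type*}

/-- The set `R(H)` of edge types of `H`: the cardinalities of its edges. Hypergraphs are finite
wherever this is used. -/
def edgeTypes (H : Hypergraph α) : Set ℕ := Set.ncard '' H.edgeSet

/-- `H` is (isomorphic to) a sub-graph of `G`: some map that is injective on the vertices of `H`
sends vertices of `H` to vertices of `G` and edges of `H` to edges of `G`. -/
def IsContainedIn (H : Hypergraph α) (G : Hypergraph β) : Prop :=
  ∃ f : α → β, Set.MapsTo f H.vertexSet G.vertexSet ∧ Set.InjOn f H.vertexSet ∧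
    ∀ e ∈ H.edgeSet, f '' e ∈ G.edgeSet

/-- The Lubell function `h_n(G)`, the sum of `1 / binom(n, |e|)` over the edges `e` of a
hypergraph `G` on `n` vertices. -/
noncomputable def lubell (G : Hypergraph α) : ℝ :=
  ∑ᶠ e ∈ G.edgeSet, 1 / (G.vertexSet.ncard.choose e.ncard : ℝ)

/-- The edge densities `h_n(G)` of the `H`-free hypergraphs `G` on `n` vertices whose edge
types all belong to `R(H)`. -/
def freeDensities (H : Hypergraph α) (n : ℕ) : Set ℝ :=
  {x | ∃ G : Hypergraph (Fin n), G.vertexSet = Set.univ ∧ G.edgeTypes ⊆ H.edgeTypes ∧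
    ¬ H.IsContainedIn G ∧ x = G.lubell}

/-- `π_n(H)`: the maximum edge density of an `H`-free hypergraph on `n` vertices with edge types
in `R(H)`. -/
noncomputable def turanNumber (H : Hypergraph α) (n : ℕ) : ℝ := sSup (H.freeDensities n)

/-- As soon as `H` has an edge, the supremum defining `π_n(H)` is a maximum. -/
theorem isGreatest_turanNumber (H : Hypergraph α) (hH : H.edgeSet.Nonempty) (n : ℕ) :
    IsGreatest (H.freeDensities n) (H.turanNumber n) := by
  have hinj : Function.Injective
      (fun G : Hypergraph (Fin n) => (G.vertexSet, G.edgeSet)) := by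
    intro G G' h
    simp only [Prod.mk.injEq] at h
    exact Hypergraph.ext h.1 h.2
  have : Finite (Hypergraph (Fin n)) := Finite.of_injective _ hinj
  have hfin : (H.freeDensities n).Finite := by
    refine (Set.finite_range (fun G : Hypergraph (Fin n) => G.lubell)).subset ?_
    rintro x ⟨G, -, -, -, rfl⟩
    exact ⟨G, rfl⟩
  have hne : (H.freeDensities n).Nonempty := by
    refine ⟨_, trivialOn Set.univ, rfl, ?_, ?_, rfl⟩
    · rintro x ⟨e, he, -⟩
      exact absurd he (Set.notMem_empty e)
    · rintro ⟨f, -, -, hf⟩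
      obtain ⟨e, he⟩ := hH
      exact Set.notMem_empty _ (hf e he)
  exact ⟨hne.csSup_mem hfin, fun x hx => le_csSup hfin.bddAbove hx⟩

/-- `H` has Turán density `c`, that is, `π(H) = lim π_n(H)` exists and equals `c`. -/
def HasTuranDensity (H : Hypergraph α) (c : ℝ) : Prop :=
  Tendsto H.turanNumber atTop (𝓝 c)

/-- `H` is degenerate: `π(H) = |R(H)| - 1`. -/
def IsDegenerate (H : Hypergraph α) : Prop :=
  H.HasTuranDensity ((H.edgeTypes.ncard : ℝ) - 1)

/-- The blow-up of `H` that replaces each vertex `i` by the class `V_i = {(i, j) | j < s i}` of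
size `s i`; an edge consists of one vertex of each class `V_i`, `i ∈ F`, for an edge `F` of `H`. -/
def blowUp (H : Hypergraph α) (s : α → ℕ) : Hypergraph (α × ℕ) where
  vertexSet := {p | p.1 ∈ H.vertexSet ∧ p.2 < s p.1}
  edgeSet := {e | ∃ F ∈ H.edgeSet, ∃ g : α → ℕ, (∀ i ∈ F, g i < s i) ∧
    e = (fun i => (i, g i)) '' F}
  subset_vertexSet_of_mem_edgeSet' := by
    rintro e ⟨F, hF, g, hg, rfl⟩ p ⟨i, hi, rfl⟩
    exact ⟨H.subset_vertexSet_of_mem_edgeSet' hF hi, hg i hi⟩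

/-- The chain `C^R`, with vertices `1, …, max R` and edges `[k] = {1, …, k}` for `k ∈ R`. -/
def chain (R : Finset ℕ) : Hypergraph ℕ where
  vertexSet := Set.Icc 1 (R.sup id)
  edgeSet := {e | ∃ k ∈ R, e = Set.Icc 1 k}
  subset_vertexSet_of_mem_edgeSet' := by
    rintro e ⟨k, hk, rfl⟩
    exact Set.Icc_subset_Icc_right (Finset.le_sup (f := id) hk)

/-- `H` is a sub-graph of a blow-up of the chain `C^R` (with all classes nonempty). -/
def IsContainedInBlowUpOfChain (H : Hypergraph α) (R : Finset ℕ) : Prop :=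
  ∃ s : ℕ → ℕ, (∀ i ∈ (chain R).vertexSet, 0 < s i) ∧ H.IsContainedIn ((chain R).blowUp s)

end Hypergraph

/-! The lower bound `|R| - 1` holds for any `H` with `R(H) = R`: take all sets with sizes in `R`
except one size. The work lies in the upper bound and in the choice of `H`.

Upper bound. Fix finitely many test sets with nonnegative weights, of total weight one for each size
in `R`. Under a random injection into `G`, the expected weight of the test sets that land on edges
is the Lubell function of `G`. If it exceeds `|R| - 1` by `ε`, then a positive proportion of the
injections have pattern weight above `|R| - 1`, and by pigeonhole one pattern `P` occurs with
positive density. Erdős's box argument (`exists_box`) then yields a large blow-up of `P` inside `G`.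
So `H` is degenerate as soon as every pattern of weight above `|R| - 1` receives a homomorphism from
`H`. This finite condition is `Forces`.

Non-triviality. Containment in a blow-up of the chain gives a projection to the chain that is
injective on edges and nests their images by size; `NotChainLike` denies that any such map exists.

Constructions. For `|R| ≥ 3`, one edge of each size suffices, since only the full pattern has weight
above `|R| - 1`. For two sizes, adding a common vertex to all edges preserves both conditions, which
leaves `{1, b}` with `b ≥ 3` and `{2, 3}`. Each is settled by a tight path with extra edges tying
its ends together, tested on a set of `b + 1` or of four points. -/

namespace Hypergraph

/-! ### Boxes in dense sets of tuples. -/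

/-- Most maps from a set with `k + 1` elements to a large set are injective. -/
theorem card_injective_ge (k n : ℕ) (hn : k ≤ n) (hn0 : 0 < n) :
    (n : ℝ) ^ (k + 1) - k * (k + 1) * (n : ℝ) ^ k ≤
      (Finset.univ.filter fun z : Fin (k + 1) → Fin n => Function.Injective z).card := by
  have hcard : (Finset.univ.filter fun z : Fin (k + 1) → Fin n => Function.Injective z).card
      = n.descFactorial (k + 1) := by
    rw [← Fintype.card_subtype,
      Fintype.card_congr (Equiv.subtypeInjectiveEquivEmbedding (Fin (k + 1)) (Fin n)),
      Fintype.card_embedding_eq, Fintype.card_fin, Fintype.card_fin]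
  have h1 : (n - k) ^ (k + 1) ≤ n.descFactorial (k + 1) := by
    have := Nat.pow_sub_le_descFactorial n (k + 1)
    rwa [Nat.add_sub_add_right] at this
  have h2 : ((n : ℝ) - k) ^ (k + 1) ≤ (n.descFactorial (k + 1) : ℝ) := by
    rw [← Nat.cast_sub hn]
    exact_mod_cast h1
  rw [hcard]
  refine le_trans ?_ h2
  have hn' : (0 : ℝ) < n := by exact_mod_cast hn0
  have hk : (k : ℝ) ≤ n := by exact_mod_cast hn
  -- Bernoulli's inequality for `(1 - k / n) ^ (k + 1)`.
  have hb := one_add_mul_le_pow (a := -((k : ℝ) / n)) (by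
    have : (k : ℝ) / n ≤ 1 := (div_le_one hn').2 hk
    linarith) (k + 1)
  have e1 : ((n : ℝ) - k) ^ (k + 1) = (n : ℝ) ^ (k + 1) * (1 + -((k : ℝ) / n)) ^ (k + 1) := by
    rw [← mul_pow]
    congr 1
    field_simp
    ring
  have e2 : (n : ℝ) ^ (k + 1) - k * (k + 1) * (n : ℝ) ^ k =
      (n : ℝ) ^ (k + 1) * (1 + ((k + 1 : ℕ) : ℝ) * -((k : ℝ) / n)) := by
    push_cast
    field_simp
    ring
  rw [e1, e2]
  exact mul_le_mul_of_nonneg_left hb (by positivity)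

/-- A dense set of `m`-tuples contains a box all of whose sides have `k + 1` elements. -/
theorem exists_box (k : ℕ) (m : ℕ) : ∀ δ : ℝ, 0 < δ → ∃ n₀ : ℕ, ∀ n ≥ n₀,
    ∀ D : Finset (Fin m → Fin n), δ * (n : ℝ) ^ m ≤ D.card →
      ∃ x : Fin m → Fin (k + 1) → Fin n, (∀ i, Function.Injective (x i)) ∧
        ∀ j : Fin m → Fin (k + 1), (fun i => x i (j i)) ∈ D := by
  classical
  induction m with
  | zero =>
    intro δ hδ
    refine ⟨0, fun n _ D hD => ⟨fun i => i.elim0, fun i => i.elim0, fun j => ?_⟩⟩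
    have hpos : (0 : ℝ) < D.card := lt_of_lt_of_le (by simpa using hδ) hD
    obtain ⟨y, hy⟩ := Finset.card_pos.1 (by exact_mod_cast hpos : 0 < D.card)
    rwa [Subsingleton.elim (fun i : Fin 0 => _) y]
  | succ m ih =>
    intro δ hδ
    obtain ⟨n₁, hn₁⟩ := ih (δ ^ (k + 1) / 2) (by positivity)
    -- Beyond this bound the non-injective `z`, at most `k (k + 1) n ^ k` in number, account for
    -- less than half of the total in `hpow`.
    obtain ⟨n₂, hn₂⟩ := exists_nat_gt (2 * (k * (k + 1) : ℝ) / δ ^ (k + 1))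
    refine ⟨max n₁ (max n₂ (k + 1)), fun n hn D hD => ?_⟩
    have hnn₁ : n₁ ≤ n := le_trans (le_max_left _ _) hn
    have hnn₂ : n₂ ≤ n := le_trans (le_trans (le_max_left _ _) (le_max_right _ _)) hn
    have hnk : k + 1 ≤ n := le_trans (le_trans (le_max_right _ _) (le_max_right _ _)) hn
    have hn0 : (0 : ℝ) < n := by exact_mod_cast (show 0 < n by omega)
    -- Double counting of pairs `(y, z)` in which every entry of `z` extends the tail `y` into `D`:
    -- by tails this counts `|A y| ^ (k + 1)`, by `z` it counts `|B z|`. Convexity bounds the first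
    -- sum from below.
    let A : (Fin m → Fin n) → Finset (Fin n) := fun y =>
      Finset.univ.filter fun a => (Fin.cons a y : Fin (m + 1) → Fin n) ∈ D
    let B : (Fin (k + 1) → Fin n) → Finset (Fin m → Fin n) := fun z =>
      Finset.univ.filter fun y => ∀ i, (Fin.cons (z i) y : Fin (m + 1) → Fin n) ∈ D
    have hA : ∑ y, ((A y).card : ℝ) = D.card := by
      have h1 : D.card = ∑ y : Fin m → Fin n, (A y).card := by
        rw [Finset.card_eq_sum_card_fiberwise (f := fun g : Fin (m + 1) → Fin n => Fin.tail g)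
          (t := Finset.univ) (fun _ _ => Finset.mem_coe.2 (Finset.mem_univ _))]
        refine Finset.sum_congr rfl fun y _ => ?_
        refine Finset.card_bij (fun g _ => g 0) ?_ ?_ ?_
        · intro g hg
          simp only [Finset.mem_filter] at hg
          simp only [A, Finset.mem_filter, Finset.mem_univ, true_and]
          rw [← hg.2, Fin.cons_self_tail]
          exact hg.1
        · intro g hg g' hg' h
          simp only [Finset.mem_filter] at hg hg'
          rw [← Fin.cons_self_tail g, ← Fin.cons_self_tail g', hg.2, hg'.2, h]
        · intro a ha
          simp only [A, Finset.mem_filter, Finset.mem_univ, true_and] at ha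
          exact ⟨Fin.cons a y, by simp [ha], by simp⟩
      rw [h1]
      push_cast
      rfl
    have hAB : ∑ y, ((A y).card : ℝ) ^ (k + 1) = ∑ z, ((B z).card : ℝ) := by
      have h1 : ∀ y, (A y).card ^ (k + 1) =
          ∑ z : Fin (k + 1) → Fin n, if y ∈ B z then 1 else 0 := by
        intro y
        rw [← Finset.card_filter]
        have : (Finset.univ.filter fun z => y ∈ B z) = Fintype.piFinset fun _ => A y := by
          ext z
          simp [A, B, Fintype.mem_piFinset]
        rw [this, Fintype.card_piFinset]
        simp
      have h2 : ∑ y, (A y).card ^ (k + 1) = ∑ z, (B z).card := by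
        simp_rw [h1]
        rw [Finset.sum_comm]
        refine Finset.sum_congr rfl fun z _ => ?_
        rw [← Finset.card_filter]
        congr 1
        ext y
        simp
      exact_mod_cast h2
    have hpow : δ ^ (k + 1) * (n : ℝ) ^ (k + 1) * (n : ℝ) ^ m ≤ ∑ z, ((B z).card : ℝ) := by
      rw [← hAB]
      have hp := pow_sum_div_card_le_sum_pow (s := (Finset.univ : Finset (Fin m → Fin n)))
        (f := fun y => ((A y).card : ℝ)) (fun _ _ => by positivity) k
      refine le_trans ?_ hp
      rw [hA]
      have hc : ((Finset.univ : Finset (Fin m → Fin n)).card : ℝ) = (n : ℝ) ^ m := by simp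
      rw [hc, le_div_iff₀ (by positivity)]
      calc δ ^ (k + 1) * (n : ℝ) ^ (k + 1) * (n : ℝ) ^ m * ((n : ℝ) ^ m) ^ k
          = (δ * (n : ℝ) ^ (m + 1)) ^ (k + 1) := by ring
        _ ≤ _ := pow_le_pow_left₀ (by positivity) hD _
    obtain ⟨z, hz, hBz⟩ : ∃ z : Fin (k + 1) → Fin n, Function.Injective z ∧
        δ ^ (k + 1) / 2 * (n : ℝ) ^ m ≤ (B z).card := by
      by_contra! hcon
      let I := Finset.univ.filter fun z : Fin (k + 1) → Fin n => Function.Injective z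
      let J := Finset.univ.filter fun z : Fin (k + 1) → Fin n => ¬ Function.Injective z
      have hIJ : (I.card : ℝ) + J.card = (n : ℝ) ^ (k + 1) := by
        have := Finset.card_filter_add_card_filter_not
          (s := (Finset.univ : Finset (Fin (k + 1) → Fin n))) (fun z => Function.Injective z)
        simp only [Finset.card_univ, Fintype.card_fun, Fintype.card_fin] at this
        exact_mod_cast this
      have hI := card_injective_ge k n (by omega) (by omega)
      have hJ : (J.card : ℝ) ≤ k * (k + 1) * (n : ℝ) ^ k := by
        have : (n : ℝ) ^ (k + 1) - k * (k + 1) * (n : ℝ) ^ k ≤ I.card := hI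
        linarith
      have hIpos : (0 : ℝ) < I.card := by
        have : (Fin.castLE hnk : Fin (k + 1) → Fin n) ∈ I := by
          simp [I, Fin.castLE_injective]
        exact_mod_cast Finset.card_pos.2 ⟨_, this⟩
      have hsumI : ∑ z ∈ I, ((B z).card : ℝ) < I.card * (δ ^ (k + 1) / 2 * (n : ℝ) ^ m) := by
        have hne : I.Nonempty := Finset.card_pos.1 (by exact_mod_cast hIpos)
        calc _ < ∑ z ∈ I, (δ ^ (k + 1) / 2 * (n : ℝ) ^ m) :=
              Finset.sum_lt_sum_of_nonempty hne fun z hz => hcon z (Finset.mem_filter.1 hz).2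
          _ = _ := by simp
      have hsumJ : ∑ z ∈ J, ((B z).card : ℝ) ≤ J.card * (n : ℝ) ^ m := by
        calc _ ≤ ∑ z ∈ J, (n : ℝ) ^ m := Finset.sum_le_sum fun z _ => by
                have := Finset.card_le_univ (B z)
                simp only [Fintype.card_fun, Fintype.card_fin] at this
                exact_mod_cast this
          _ = _ := by simp
      have hsplit : ∑ z, ((B z).card : ℝ) = ∑ z ∈ I, ((B z).card : ℝ) + ∑ z ∈ J, ((B z).card : ℝ) :=
        (Finset.sum_filter_add_sum_filter_not _ _ _).symm
      have hnm : (0 : ℝ) < (n : ℝ) ^ m := by positivity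
      have hIle : (I.card : ℝ) ≤ (n : ℝ) ^ (k + 1) := by
        have : (0 : ℝ) ≤ J.card := by positivity
        linarith
      have hb1 : (I.card : ℝ) * (δ ^ (k + 1) / 2 * (n : ℝ) ^ m) ≤
          (n : ℝ) ^ (k + 1) * (δ ^ (k + 1) / 2 * (n : ℝ) ^ m) :=
        mul_le_mul_of_nonneg_right hIle (by positivity)
      have hb2 : (J.card : ℝ) * (n : ℝ) ^ m ≤ k * (k + 1) * (n : ℝ) ^ k * (n : ℝ) ^ m :=
        mul_le_mul_of_nonneg_right hJ hnm.le
      have hfin : δ ^ (k + 1) * (n : ℝ) ^ (k + 1) * (n : ℝ) ^ m <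
          (n : ℝ) ^ (k + 1) * (δ ^ (k + 1) / 2 * (n : ℝ) ^ m) +
            k * (k + 1) * (n : ℝ) ^ k * (n : ℝ) ^ m := by linarith
      have hlarge : 2 * (k * (k + 1) : ℝ) < n * δ ^ (k + 1) := by
        rw [← div_lt_iff₀ (by positivity)]
        exact hn₂.trans_le (by exact_mod_cast hnn₂)
      have hnk' : (0 : ℝ) < (n : ℝ) ^ k * (n : ℝ) ^ m := by positivity
      have := mul_lt_mul_of_pos_right hlarge hnk'
      rw [pow_succ (n : ℝ) k] at hfin
      nlinarith
    obtain ⟨x, hx, hxB⟩ := hn₁ n hnn₁ (B z) hBz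
    refine ⟨Fin.cons z x, fun i => ?_, fun j => ?_⟩
    · refine Fin.cases ?_ (fun i => ?_) i
      · simpa using hz
      · simpa using hx i
    · have h := hxB (fun i => j i.succ)
      simp only [B, Finset.mem_filter, Finset.mem_univ, true_and] at h
      convert h (j 0) using 1
      funext i
      refine Fin.cases ?_ (fun i => ?_) i <;> simp

/-! ### Random injections and edge densities. -/

/-- Any two finite sets of the same size are exchanged by a permutation of the ambient type. -/
theorem exists_perm_map_eq {α : Type*} [Fintype α] [DecidableEq α] (g g' : Finset α)
    (h : g.card = g'.card) : ∃ σ : Equiv.Perm α, g.map σ.toEmbedding = g' := by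
  let e : {x // x ∈ g} ≃ {x // x ∈ g'} := Finset.equivOfCardEq h
  refine ⟨e.extendSubtype, Finset.eq_of_subset_of_card_le ?_ (by simp [h])⟩
  intro y hy
  obtain ⟨x, hx, rfl⟩ := Finset.mem_map.1 hy
  exact e.extendSubtype_mem x hx

/-- The probability that a random injection maps a fixed `r`-set to a member of `𝒢` is the
density of the `r`-sets of `𝒢`. -/
theorem card_embedding_map_mem {m n : ℕ} (𝒢 : Finset (Finset (Fin n))) (e : Finset (Fin m)) :
    (Finset.univ.filter fun φ : Fin m ↪ Fin n => e.map φ ∈ 𝒢).card * n.choose e.card =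
      Fintype.card (Fin m ↪ Fin n) * (𝒢.filter fun g => g.card = e.card).card := by
  classical
  let N : Finset (Fin n) → ℕ := fun g =>
    (Finset.univ.filter fun φ : Fin m ↪ Fin n => e.map φ = g).card
  -- By symmetry, the number of injections taking `e` onto `g` depends only on `|g|`.
  have hN : ∀ g g' : Finset (Fin n), g.card = g'.card → N g = N g' := by
    intro g g' h
    obtain ⟨σ, rfl⟩ := exists_perm_map_eq g g' h
    refine Finset.card_bij (fun φ _ => φ.trans σ.toEmbedding) ?_ ?_ ?_
    · intro φ hφ
      simp only [Finset.mem_filter, Finset.mem_univ, true_and] at hφ ⊢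
      rw [← Finset.map_map, hφ]
    · intro φ _ φ' _ h
      ext i
      have := DFunLike.congr_fun h i
      simpa using congrArg Fin.val (σ.injective this)
    · intro φ hφ
      simp only [Finset.mem_filter, Finset.mem_univ, true_and] at hφ
      refine ⟨φ.trans σ.symm.toEmbedding, ?_, ?_⟩
      · simp only [Finset.mem_filter, Finset.mem_univ, true_and]
        rw [← Finset.map_map, hφ, Finset.map_map]
        ext; simp
      · ext i; simp
  have htot : Fintype.card (Fin m ↪ Fin n) =
      ∑ g ∈ Finset.powersetCard e.card (Finset.univ : Finset (Fin n)), N g := by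
    rw [← Finset.card_univ]
    refine Finset.card_eq_sum_card_fiberwise fun φ _ => ?_
    simp [Finset.mem_powersetCard]
  have hmem : (Finset.univ.filter fun φ : Fin m ↪ Fin n => e.map φ ∈ 𝒢).card =
      ∑ g ∈ 𝒢.filter fun g => g.card = e.card, N g := by
    rw [Finset.card_eq_sum_card_fiberwise (f := fun φ : Fin m ↪ Fin n => e.map φ)
      (t := 𝒢.filter fun g => g.card = e.card)]
    · refine Finset.sum_congr rfl fun g hg => ?_
      congr 1
      ext φ
      simp only [Finset.mem_filter, Finset.mem_univ, true_and, and_iff_right_iff_imp]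
      rintro rfl
      exact (Finset.mem_filter.1 hg).1
    · intro φ hφ
      simpa using hφ
  rw [hmem, htot, mul_comm (∑ g ∈ _, N g), mul_comm (∑ g ∈ _, N g), Finset.mul_sum,
    ← smul_eq_mul (Finset.card _), ← Finset.sum_const]
  refine Finset.sum_congr rfl fun g hg => ?_
  rw [Finset.sum_congr rfl (g := fun _ => N g) fun g' hg' =>
    hN _ _ ((Finset.mem_powersetCard.1 hg').2.trans (Finset.mem_filter.1 hg).2.symm)]
  simp

/-- The hypergraph spanned by a finite family of finite sets of natural numbers. -/
def ofEdges (E : Finset (Finset ℕ)) : Hypergraph ℕ where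
  vertexSet := {v | ∃ e ∈ E, v ∈ e}
  edgeSet := {e | ∃ e' ∈ E, e = (e' : Set ℕ)}
  subset_vertexSet_of_mem_edgeSet' := by
    rintro e ⟨e', he', rfl⟩ v hv
    exact ⟨e', he', hv⟩

theorem finite_vertexSet_ofEdges (E : Finset (Finset ℕ)) : (ofEdges E).vertexSet.Finite := by
  refine (E.biUnion id).finite_toSet.subset ?_
  rintro v ⟨e, he, hv⟩
  exact Finset.mem_coe.2 (Finset.mem_biUnion.2 ⟨e, he, hv⟩)

theorem edgeTypes_ofEdges (E : Finset (Finset ℕ)) :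
    (ofEdges E).edgeTypes = (E.image Finset.card : Set ℕ) := by
  ext r
  simp only [edgeTypes, ofEdges, Set.mem_image, Set.mem_ofPred_eq, Finset.coe_image, Finset.mem_coe]
  constructor
  · rintro ⟨_, ⟨e, he, rfl⟩, rfl⟩
    exact ⟨e, he, (Set.ncard_coe_finset e).symm⟩
  · rintro ⟨e, he, rfl⟩
    exact ⟨_, ⟨e, he, rfl⟩, Set.ncard_coe_finset e⟩

/-- The edges of a hypergraph on `Fin n`, as a finset of finsets. -/
noncomputable def edgeFinsets {n : ℕ} (G : Hypergraph (Fin n)) : Finset (Finset (Fin n)) := by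
  classical exact Finset.univ.filter fun g => (g : Set (Fin n)) ∈ G.edgeSet

theorem mem_edgeFinsets {n : ℕ} {G : Hypergraph (Fin n)} {g : Finset (Fin n)} :
    g ∈ G.edgeFinsets ↔ (g : Set (Fin n)) ∈ G.edgeSet := by
  simp [edgeFinsets]

theorem lubell_eq_sum_edgeFinsets {n : ℕ} (G : Hypergraph (Fin n)) (hG : G.vertexSet = Set.univ) :
    G.lubell = ∑ g ∈ G.edgeFinsets, 1 / (n.choose g.card : ℝ) := by
  classical
  have h : G.edgeSet = (fun g : Finset (Fin n) => (g : Set (Fin n))) '' G.edgeFinsets := by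
    ext e
    simp only [Set.mem_image, Finset.mem_coe, mem_edgeFinsets]
    constructor
    · intro he
      exact ⟨e.toFinite.toFinset, by simpa using he, by simp⟩
    · rintro ⟨g, hg, rfl⟩
      exact hg
  rw [lubell, h, finsum_mem_image Finset.coe_injective.injOn, finsum_mem_coe_finset, hG]
  simp [Set.ncard_coe_finset]

/-- The Lubell function is the sum of the edge densities over the edge types. -/
theorem lubell_eq_sum_density {n : ℕ} (G : Hypergraph (Fin n)) (hG : G.vertexSet = Set.univ)
    (R : Finset ℕ) (hR : G.edgeTypes ⊆ R) :
    G.lubell = ∑ r ∈ R, ((G.edgeFinsets.filter fun g => g.card = r).card : ℝ) / n.choose r := by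
  classical
  rw [lubell_eq_sum_edgeFinsets G hG, ← Finset.sum_fiberwise_of_maps_to (t := R) (g := Finset.card)]
  · refine Finset.sum_congr rfl fun r _ => ?_
    rw [Finset.sum_congr rfl (g := fun _ => 1 / (n.choose r : ℝ)) fun g hg => by
      rw [(Finset.mem_filter.1 hg).2]]
    rw [Finset.sum_const, nsmul_eq_mul, mul_one_div]
  · intro g hg
    exact Finset.mem_coe.1 (hR ⟨_, mem_edgeFinsets.1 hg, Set.ncard_coe_finset g⟩)

/-- A hypergraph with at least one edge of each size in `R` has Turán numbers at least
`|R| - 1`. -/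
theorem card_sub_one_le_turanNumber (H : Hypergraph ℕ) (R : Finset ℕ) (hH : H.edgeTypes = R)
    (hR : R.Nonempty) (n : ℕ) (hn : ∀ r ∈ R, r ≤ n) :
    (R.card : ℝ) - 1 ≤ H.turanNumber n := by
  classical
  obtain ⟨r₀, hr₀⟩ := hR
  obtain ⟨e₀, he₀, hcard₀⟩ : r₀ ∈ H.edgeTypes := by rw [hH]; exact hr₀
  -- All sets with sizes in `R` other than `r₀`: an edge of `H` of size `r₀` has nowhere to go.
  let G : Hypergraph (Fin n) :=
    { vertexSet := Set.univ
      edgeSet := {g | g.ncard ∈ R.erase r₀}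
      subset_vertexSet_of_mem_edgeSet' := fun _ _ => Set.subset_univ _ }
  have hle : (G.lubell : ℝ) ≤ H.turanNumber n := by
    refine (isGreatest_turanNumber H ⟨e₀, he₀⟩ n).2 ⟨G, rfl, ?_, ?_, rfl⟩
    · rintro _ ⟨g, hg, rfl⟩
      rw [hH]
      exact Finset.mem_of_mem_erase hg
    · rintro ⟨f, -, hinj, hf⟩
      have h := hf e₀ he₀
      have hc : (f '' e₀).ncard = r₀ := by
        rw [Set.InjOn.ncard_image (hinj.mono (H.subset_vertexSet_of_mem_edgeSet' he₀)), hcard₀]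
      change (f '' e₀).ncard ∈ R.erase r₀ at h
      rw [hc] at h
      exact Finset.notMem_erase r₀ R h
  refine le_trans (le_of_eq ?_) hle
  rw [lubell_eq_sum_density G rfl (R.erase r₀) (by rintro _ ⟨g, hg, rfl⟩; exact hg)]
  have hterm : ∀ r ∈ R.erase r₀,
      ((G.edgeFinsets.filter fun g => g.card = r).card : ℝ) / n.choose r = 1 := by
    intro r hr
    have : (G.edgeFinsets.filter fun g => g.card = r) = Finset.powersetCard r Finset.univ := by
      ext g
      simp only [Finset.mem_filter, mem_edgeFinsets, Finset.mem_powersetCard, Finset.subset_univ,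
        true_and, and_iff_right_iff_imp]
      rintro rfl
      change (g : Set (Fin n)).ncard ∈ R.erase r₀
      rwa [Set.ncard_coe_finset]
    rw [this, Finset.card_powersetCard, Finset.card_univ, Fintype.card_fin, div_self]
    exact_mod_cast (Nat.choose_pos (hn r (Finset.mem_of_mem_erase hr))).ne'
  rw [Finset.sum_congr rfl hterm, Finset.sum_const, Finset.card_erase_of_mem hr₀, nsmul_eq_mul,
    mul_one, Nat.cast_sub (Finset.card_pos.2 ⟨r₀, hr₀⟩), Nat.cast_one]

/-! ### Forced families are degenerate. -/

/-- Some weighted finite system of test sets, of total weight one for each size in `R`, has the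
property that every subsystem of weight more than `|R| - 1` contains a homomorphic image of `E`. -/
def Forces (R : Finset ℕ) (E : Finset (Finset ℕ)) : Prop :=
  ∃ (T : Finset (Finset ℕ)) (w : Finset ℕ → ℝ), (∀ t ∈ T, 0 ≤ w t) ∧ (∀ t ∈ T, t.card ∈ R) ∧
    (∀ r ∈ R, ∑ t ∈ T with t.card = r, w t = 1) ∧
    ∀ P ⊆ T, (R.card : ℝ) - 1 < ∑ t ∈ P, w t →
      ∃ f : ℕ → ℕ, ∀ e ∈ E, Set.InjOn f e ∧ e.image f ∈ P

/-- A weighted average of test sets, each mapped by a random injection, hits `G` with expected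
weight equal to the Lubell function of `G`. -/
theorem sum_weight_embedding {m n : ℕ} (hmn : m ≤ n) (R : Finset ℕ) (T : Finset (Finset ℕ))
    (w : Finset ℕ → ℝ)
    (hTR : ∀ t ∈ T, t.card ∈ R) (hw1 : ∀ r ∈ R, ∑ t ∈ T with t.card = r, w t = 1)
    (hTm : ∀ t ∈ T, t ⊆ Finset.range m) (lift : Finset ℕ → Finset (Fin m))
    (hlift : ∀ t ∈ T, (lift t).card = t.card) (G : Hypergraph (Fin n))
    (hG : G.vertexSet = Set.univ) (hGR : G.edgeTypes ⊆ R) :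
    ∑ φ : Fin m ↪ Fin n, ∑ t ∈ T with (lift t).map φ ∈ G.edgeFinsets, w t =
      Fintype.card (Fin m ↪ Fin n) * G.lubell := by
  classical
  have h1 : ∀ t ∈ T, (((Finset.univ.filter fun φ : Fin m ↪ Fin n =>
      (lift t).map φ ∈ G.edgeFinsets).card : ℕ) : ℝ) = Fintype.card (Fin m ↪ Fin n) *
        (((G.edgeFinsets.filter fun g => g.card = t.card).card : ℝ) / n.choose t.card) := by
    intro t ht
    have h := card_embedding_map_mem G.edgeFinsets (lift t)
    rw [hlift t ht] at h
    have hle : t.card ≤ n := by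
      have := Finset.card_le_card (hTm t ht)
      rw [Finset.card_range] at this
      omega
    have hpos : (0 : ℝ) < n.choose t.card := by exact_mod_cast Nat.choose_pos hle
    rw [← mul_div_assoc, eq_div_iff hpos.ne']
    exact_mod_cast h
  calc ∑ φ : Fin m ↪ Fin n, ∑ t ∈ T with (lift t).map φ ∈ G.edgeFinsets, w t
      = ∑ t ∈ T, w t * (Finset.univ.filter fun φ : Fin m ↪ Fin n =>
          (lift t).map φ ∈ G.edgeFinsets).card := by
        simp_rw [Finset.sum_filter]
        rw [Finset.sum_comm]
        refine Finset.sum_congr rfl fun t _ => ?_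
        rw [← Finset.sum_filter, Finset.sum_const, nsmul_eq_mul, mul_comm]
    _ = ∑ t ∈ T, Fintype.card (Fin m ↪ Fin n) * (w t *
          (((G.edgeFinsets.filter fun g => g.card = t.card).card : ℝ) / n.choose t.card)) := by
        refine Finset.sum_congr rfl fun t ht => ?_
        rw [h1 t ht]
        ring
    _ = _ := by
        rw [← Finset.mul_sum, lubell_eq_sum_density G hG R hGR,
          ← Finset.sum_fiberwise_of_maps_to (t := R) (g := Finset.card) hTR]
        congr 1
        refine Finset.sum_congr rfl fun r hr => ?_
        rw [Finset.sum_congr rfl (g := fun t => w t *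
          (((G.edgeFinsets.filter fun g => g.card = r).card : ℝ) / n.choose r)) fun t ht => by
            rw [(Finset.mem_filter.1 ht).2], ← Finset.sum_mul, hw1 r hr, one_mul]

/-- Boxes of embeddings with a common pattern `P` contain every hypergraph that maps
homomorphically to `P`. -/
theorem isContainedIn_of_box {m n k : ℕ} (G : Hypergraph (Fin n)) (hG : G.vertexSet = Set.univ)
    (E P : Finset (Finset ℕ)) (hPm : ∀ t ∈ P, t ⊆ Finset.range m) (hn : 0 < n)
    (hE : ∀ e ∈ E, e ⊆ Finset.range (k + 1))
    (f : ℕ → ℕ) (hf : ∀ e ∈ E, Set.InjOn f e ∧ e.image f ∈ P)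
    (x : Fin m → Fin (k + 1) → Fin n) (hx : ∀ i, Function.Injective (x i))
    (hxinj : ∀ j : Fin m → Fin (k + 1), Function.Injective fun i => x i (j i))
    (hxP : ∀ j : Fin m → Fin (k + 1), ∀ t ∈ P,
      (fun i => x i (j i)) '' {i | (i : ℕ) ∈ t} ∈ G.edgeSet) :
    (ofEdges E).IsContainedIn G := by
  classical
  have hfm : ∀ e ∈ E, ∀ v ∈ e, f v < m := fun e he v hv =>
    Finset.mem_range.1 (hPm _ (hf e he).2 (Finset.mem_image_of_mem f hv))
  have hvk : ∀ e ∈ E, ∀ v ∈ e, v < k + 1 := fun e he v hv => Finset.mem_range.1 (hE e he hv)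
  -- Vertex `v` goes to the class of `f v`, at position `v` itself, so vertices identified by `f`
  -- stay distinct. The default value is never used on vertices of `E`.
  let g : ℕ → Fin n := fun v =>
    if h : f v < m ∧ v < k + 1 then x ⟨f v, h.1⟩ ⟨v, h.2⟩ else ⟨0, hn⟩
  have hg : ∀ v (h1 : f v < m) (h2 : v < k + 1), g v = x ⟨f v, h1⟩ ⟨v, h2⟩ := fun v h1 h2 =>
    dif_pos ⟨h1, h2⟩
  refine ⟨g, fun _ _ => hG ▸ Set.mem_univ _, ?_, ?_⟩
  · rintro v ⟨e, he, hv⟩ v' ⟨e', he', hv'⟩ hvv'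
    rw [hg v (hfm e he v hv) (hvk e he v hv), hg v' (hfm e' he' v' hv') (hvk e' he' v' hv')] at hvv'
    by_cases hff : f v = f v'
    · have : (⟨f v, hfm e he v hv⟩ : Fin m) = ⟨f v', hfm e' he' v' hv'⟩ := Fin.ext hff
      rw [this] at hvv'
      simpa using hx _ hvv'
    · exfalso
      -- One selection from the box passes through both images, so `hxinj` separates different
      -- classes.
      let j : Fin m → Fin (k + 1) := fun i =>
        if (i : ℕ) = f v then ⟨v, hvk e he v hv⟩ else ⟨v', hvk e' he' v' hv'⟩
      have := @hxinj j ⟨f v, hfm e he v hv⟩ ⟨f v', hfm e' he' v' hv'⟩ (by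
        simpa [j, Ne.symm hff] using hvv')
      exact hff (by simpa using this)
  · rintro _ ⟨e, he, rfl⟩
    -- Since `f` is injective on `e`, the edge meets each class at most once, so a single selection
    -- `j` contains its whole image.
    have hsec : ∀ i : Fin m, ∃ v : Fin (k + 1), ∀ u ∈ e, f u = i → u = v := by
      intro i
      by_cases h : ∃ u ∈ e, f u = i
      · obtain ⟨u, hu, hui⟩ := h
        exact ⟨⟨u, hvk e he u hu⟩, fun u' hu' hui' => (hf e he).1 hu' hu (hui'.trans hui.symm)⟩
      · exact ⟨0, fun u hu hui => absurd ⟨u, hu, hui⟩ h⟩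
    choose j hj using hsec
    have h := hxP j _ (hf e he).2
    convert h using 1
    ext y
    simp only [Set.mem_image, Set.mem_ofPred_eq, Finset.mem_image, Finset.mem_coe]
    have key : ∀ u (hu : u ∈ e), x ⟨f u, hfm e he u hu⟩ (j ⟨f u, hfm e he u hu⟩) = g u := by
      intro u hu
      rw [hg u (hfm e he u hu) (hvk e he u hu)]
      congr 1
      exact Fin.ext (hj ⟨f u, hfm e he u hu⟩ u hu rfl).symm
    constructor
    · rintro ⟨u, hu, rfl⟩
      exact ⟨⟨f u, hfm e he u hu⟩, ⟨u, hu, rfl⟩, key u hu⟩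
    · rintro ⟨i, ⟨u, hu, hui⟩, rfl⟩
      refine ⟨u, hu, ?_⟩
      have : i = ⟨f u, hfm e he u hu⟩ := Fin.ext hui.symm
      rw [this, key u hu]

/-- A family that is forced has Turán density at most `|R| - 1`. -/
theorem turanNumber_lt_of_forces (R : Finset ℕ) (E : Finset (Finset ℕ)) (hR : R.Nonempty)
    (hER : E.image Finset.card = R) (hF : Forces R E) (ε : ℝ) (hε : 0 < ε) :
    ∃ n₀, ∀ n ≥ n₀, (ofEdges E).turanNumber n < (R.card : ℝ) - 1 + ε := by
  classical
  obtain ⟨T, w, hw0, hTR, hw1, hforce⟩ := hF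
  obtain ⟨m, hTm⟩ : ∃ m, ∀ t ∈ T, t ⊆ Finset.range m := by
    obtain ⟨m, hm⟩ := (T.biUnion id).exists_nat_subset_range
    exact ⟨m, fun t ht => (Finset.subset_biUnion_of_mem id ht).trans hm⟩
  obtain ⟨k, hEk⟩ : ∃ k, ∀ e ∈ E, e ⊆ Finset.range (k + 1) := by
    obtain ⟨k, hk⟩ := (E.biUnion id).exists_nat_subset_range
    exact ⟨k, fun e he => ((Finset.subset_biUnion_of_mem id he).trans hk).trans
      (Finset.range_subset_range.2 (Nat.le_succ k))⟩
  -- The factor `2 ^ m` pays for the passage from all tuples to injections, and `2 ^ T.card` for the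
  -- pigeonhole over patterns.
  obtain ⟨n₁, hn₁⟩ := exists_box k m (ε / 2 ^ m / 2 ^ T.card) (by positivity)
  refine ⟨max n₁ (2 * m + 1), fun n hn => ?_⟩
  have hnn₁ : n₁ ≤ n := le_trans (le_max_left _ _) hn
  have hnm : 2 * m + 1 ≤ n := le_trans (le_max_right _ _) hn
  have hH : (ofEdges E).edgeTypes = R := by rw [edgeTypes_ofEdges, hER]
  obtain ⟨r₀, hr₀⟩ := hR
  obtain ⟨e₀, he₀, -⟩ : r₀ ∈ (ofEdges E).edgeTypes := by rw [hH]; exact hr₀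
  obtain ⟨G, hG, hGR, hfree, hGl⟩ := (isGreatest_turanNumber (ofEdges E) ⟨e₀, he₀⟩ n).1
  rw [hGl]
  rw [hH] at hGR
  by_contra! hlarge
  apply hfree
  let lift : Finset ℕ → Finset (Fin m) := fun t => Finset.univ.filter fun i => (i : ℕ) ∈ t
  have hlift : ∀ t ∈ T, (lift t).card = t.card := by
    intro t ht
    refine Finset.card_bij (fun i _ => (i : ℕ)) ?_ ?_ ?_
    · intro i hi
      exact (Finset.mem_filter.1 hi).2
    · intro i _ i' _ h
      exact Fin.ext h
    · intro v hv
      exact ⟨⟨v, Finset.mem_range.1 (hTm t ht hv)⟩, by simp [lift, hv], rfl⟩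
  let pat : (Fin m ↪ Fin n) → Finset (Finset ℕ) := fun φ =>
    T.filter fun t => (lift t).map φ ∈ G.edgeFinsets
  have hsum := sum_weight_embedding (by omega : m ≤ n) R T w hTR hw1 hTm lift hlift G hG hGR
  have hwT : ∑ t ∈ T, w t = R.card := by
    rw [← Finset.sum_fiberwise_of_maps_to (t := R) (g := Finset.card) hTR,
      Finset.sum_congr rfl hw1]
    simp
  let good := Finset.univ.filter fun φ : Fin m ↪ Fin n => (R.card : ℝ) - 1 < ∑ t ∈ pat φ, w t
  let N : ℝ := Fintype.card (Fin m ↪ Fin n)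
  have hgood : ε * N ≤ good.card := by
    -- A pattern weighs at most `|R|`, so a good injection exceeds `|R| - 1` by at most one.
    have h1 : ∀ φ : Fin m ↪ Fin n, ∑ t ∈ pat φ, w t ≤
        ((R.card : ℝ) - 1) + if (R.card : ℝ) - 1 < ∑ t ∈ pat φ, w t then 1 else 0 := by
      intro φ
      split_ifs with h
      · have : ∑ t ∈ pat φ, w t ≤ ∑ t ∈ T, w t :=
          Finset.sum_le_sum_of_subset_of_nonneg (Finset.filter_subset _ _) fun t ht _ => hw0 t ht
        linarith
      · linarith
    have h2 := Finset.sum_le_sum fun φ (_ : φ ∈ (Finset.univ : Finset (Fin m ↪ Fin n))) => h1 φ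
    rw [hsum, Finset.sum_add_distrib, Finset.sum_const, ← Finset.sum_filter, Finset.sum_const,
      nsmul_eq_mul, nsmul_eq_mul, mul_one, Finset.card_univ] at h2
    have h3 : N * ((R.card : ℝ) - 1 + ε) ≤ N * G.lubell :=
      mul_le_mul_of_nonneg_left hlarge (Nat.cast_nonneg _)
    change N * G.lubell ≤ N * ((R.card : ℝ) - 1) + (good.card : ℝ) at h2
    linarith
  have hN : (n : ℝ) ^ m / 2 ^ m ≤ N := by
    have h1 : (n + 1 - m) ^ m ≤ n.descFactorial m := Nat.pow_sub_le_descFactorial n m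
    have h2 : ((n : ℝ) / 2) ^ m ≤ ((n + 1 - m : ℕ) : ℝ) ^ m := by
      refine pow_le_pow_left₀ (by positivity) ?_ _
      rw [div_le_iff₀ two_pos]
      exact_mod_cast (by omega : n ≤ (n + 1 - m) * 2)
    rw [← div_pow]
    refine h2.trans ?_
    simp only [N, Fintype.card_embedding_eq, Fintype.card_fin]
    exact_mod_cast h1
  have hgood' : ε / 2 ^ m * (n : ℝ) ^ m ≤ good.card := by
    refine le_trans ?_ hgood
    calc ε / 2 ^ m * (n : ℝ) ^ m = ε * ((n : ℝ) ^ m / 2 ^ m) := by ring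
      _ ≤ _ := mul_le_mul_of_nonneg_left hN hε.le
  obtain ⟨P, hP, hPcard⟩ : ∃ P ∈ T.powerset,
      ε / 2 ^ m / 2 ^ T.card * (n : ℝ) ^ m ≤ (good.filter fun φ => pat φ = P).card := by
    by_contra! hcon
    have h1 : good.card = ∑ P ∈ T.powerset, (good.filter fun φ => pat φ = P).card :=
      Finset.card_eq_sum_card_fiberwise fun φ _ =>
        Finset.mem_coe.2 (Finset.mem_powerset.2 (Finset.filter_subset _ _))
    have h2 : (good.card : ℝ) < ∑ P ∈ T.powerset, ε / 2 ^ m / 2 ^ T.card * (n : ℝ) ^ m := by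
      rw [h1]
      push_cast
      exact Finset.sum_lt_sum_of_nonempty ⟨∅, Finset.empty_mem_powerset T⟩ hcon
    rw [Finset.sum_const, Finset.card_powerset, nsmul_eq_mul] at h2
    push_cast at h2
    have h3 : (2 : ℝ) ^ T.card * (ε / 2 ^ m / 2 ^ T.card * (n : ℝ) ^ m) =
        ε / 2 ^ m * (n : ℝ) ^ m := by
      field_simp
    linarith
  let D : Finset (Fin m → Fin n) :=
    (good.filter fun φ => pat φ = P).map ⟨fun φ : Fin m ↪ Fin n => (φ : Fin m → Fin n), DFunLike.coe_injective⟩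
  have hD : ∀ y ∈ D, ∃ φ ∈ good, pat φ = P ∧ ⇑φ = y := by
    intro y hy
    obtain ⟨φ, hφ, rfl⟩ := Finset.mem_map.1 hy
    exact ⟨φ, (Finset.mem_filter.1 hφ).1, (Finset.mem_filter.1 hφ).2, rfl⟩
  obtain ⟨x, hx, hxD⟩ := hn₁ n hnn₁ D (by rw [Finset.card_map]; exact hPcard)
  obtain ⟨φ₀, hφ₀, hpat₀, -⟩ := hD _ (hxD fun _ => 0)
  obtain ⟨f, hf⟩ := hforce P (Finset.mem_powerset.1 hP) (by
    rw [← hpat₀]; exact (Finset.mem_filter.1 hφ₀).2)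
  refine isContainedIn_of_box G hG E P (fun t ht => hTm t (Finset.mem_powerset.1 hP ht))
    (by omega) hEk f hf x hx (fun j => ?_) (fun j t ht => ?_)
  · obtain ⟨φ, -, -, hφ⟩ := hD _ (hxD j)
    rw [← hφ]
    exact φ.injective
  · obtain ⟨φ, -, hφP, hφ⟩ := hD _ (hxD j)
    rw [← hφ]
    rw [← hφP] at ht
    have := mem_edgeFinsets.1 (Finset.mem_filter.1 ht).2
    simpa [lift] using this

theorem isDegenerate_of_forces (R : Finset ℕ) (E : Finset (Finset ℕ)) (hR : R.Nonempty)
    (hER : E.image Finset.card = R) (hF : Forces R E) : (ofEdges E).IsDegenerate := by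
  have hH : (ofEdges E).edgeTypes = R := by rw [edgeTypes_ofEdges, hER]
  unfold IsDegenerate HasTuranDensity
  rw [hH, Set.ncard_coe_finset, Metric.tendsto_atTop]
  intro ε hε
  obtain ⟨n₀, hn₀⟩ := turanNumber_lt_of_forces R E hR hER hF ε hε
  refine ⟨max n₀ (R.sup id), fun n hn => ?_⟩
  have h1 := hn₀ n (le_trans (le_max_left _ _) hn)
  have h2 := card_sub_one_le_turanNumber (ofEdges E) R hH hR n fun r hr =>
    (Finset.le_sup (f := id) hr).trans (le_trans (le_max_right _ _) hn)
  rw [Real.dist_eq, abs_lt]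
  constructor <;> linarith

/-! ### The obstruction to lying in a blow-up of the chain. -/

/-- No map that is injective on the edges of `E` sends each edge of `E` into the image of every
edge that is at least as large. -/
def NotChainLike (E : Finset (Finset ℕ)) : Prop :=
  ¬ ∃ c : ℕ → ℕ, (∀ e ∈ E, Set.InjOn c e) ∧
    ∀ e ∈ E, ∀ e' ∈ E, e.card ≤ e'.card → e.image c ⊆ e'.image c

/-- Projecting the blow-up to its classes sends an edge `e` bijectively onto `{1, …, |e|}`, and
these intervals are nested by size. -/
theorem NotChainLike.not_isContainedInBlowUpOfChain {E : Finset (Finset ℕ)}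
    (hE : NotChainLike E) (R : Finset ℕ) : ¬ (ofEdges E).IsContainedInBlowUpOfChain R := by
  rintro ⟨s, -, f, -, hinj, hf⟩
  have key : ∀ e ∈ E, Set.InjOn (fun v => (f v).1) e ∧
      e.image (fun v => (f v).1) = Finset.Icc 1 e.card := by
    intro e he
    obtain ⟨F, ⟨k, hk, rfl⟩, g, -, hg⟩ := hf e ⟨e, he, rfl⟩
    have himg : e.image (fun v => (f v).1) = Finset.Icc 1 k := by
      rw [← Finset.coe_inj, Finset.coe_image, Finset.coe_Icc,
        show (fun v => (f v).1) = Prod.fst ∘ f from rfl, Set.image_comp, hg, ← Set.image_comp]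
      simp
    have hcard : e.card = k := by
      have h1 : (f '' (e : Set ℕ)).ncard = e.card := by
        rw [Set.InjOn.ncard_image, Set.ncard_coe_finset]
        exact hinj.mono ((ofEdges E).subset_vertexSet_of_mem_edgeSet' ⟨e, he, rfl⟩)
      rw [← h1, hg, Set.ncard_image_of_injective _ fun a b h => (Prod.ext_iff.1 h).1,
        ← Finset.coe_Icc, Set.ncard_coe_finset, Nat.card_Icc, Nat.add_sub_cancel]
    rw [hcard]
    refine ⟨?_, himg⟩
    rw [← Finset.card_image_iff, himg, hcard, Nat.card_Icc, Nat.add_sub_cancel]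
  refine hE ⟨_, fun e he => (key e he).1, fun e he e' he' h => ?_⟩
  rw [(key e he).2, (key e' he').2]
  exact Finset.Icc_subset_Icc_right h

/-- There is a forced family with set of edge sizes `R` that is not chain-like. -/
def HasForcedFamily (R : Finset ℕ) : Prop :=
  ∃ E : Finset (Finset ℕ), E.image Finset.card = R ∧ Forces R E ∧ NotChainLike E

/-! ### Suspension: raising all edge sizes by one. -/

/-- The edge `e` with all vertices shifted by one and the new vertex `0` added. -/
def suspend (e : Finset ℕ) : Finset ℕ := insert 0 (e.map ⟨Nat.succ, Nat.succ_injective⟩)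

theorem card_suspend (e : Finset ℕ) : (suspend e).card = e.card + 1 := by
  rw [suspend, Finset.card_insert_of_notMem (by simp), Finset.card_map]

theorem suspend_injective : Function.Injective suspend := by
  intro e e' h
  ext v
  have : v + 1 ∈ suspend e ↔ v + 1 ∈ suspend e' := by rw [h]
  simpa [suspend] using this

/-- Suspending the test sets with their weights keeps `|R|` and all pattern weights, and
homomorphisms extend by fixing `0`. -/
theorem Forces.suspend {R : Finset ℕ} {E : Finset (Finset ℕ)} (h : Forces R E) :
    Forces (R.image Nat.succ) (E.image suspend) := by
  classical
  obtain ⟨T, w, hw0, hTR, hw1, hforce⟩ := h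
  have hinv := Function.leftInverse_invFun suspend_injective
  refine ⟨T.image Hypergraph.suspend, w ∘ Function.invFun Hypergraph.suspend, ?_, ?_, ?_, ?_⟩
  · intro t ht
    obtain ⟨t, htT, rfl⟩ := Finset.mem_image.1 ht
    simpa [hinv t] using hw0 t htT
  · intro t ht
    obtain ⟨t, htT, rfl⟩ := Finset.mem_image.1 ht
    rw [card_suspend]
    exact Finset.mem_image_of_mem _ (hTR t htT)
  · intro r hr
    obtain ⟨r, hrR, rfl⟩ := Finset.mem_image.1 hr
    rw [Finset.filter_image, Finset.sum_image suspend_injective.injOn, ← hw1 r hrR]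
    refine Finset.sum_congr ?_ fun t _ => by simp [hinv t]
    ext t
    simp [card_suspend]
  · intro P hP hsum
    rw [Finset.card_image_of_injective _ Nat.succ_injective] at hsum
    obtain ⟨Q, hQ, rfl⟩ := Finset.subset_image_iff.1 hP
    rw [Finset.sum_image suspend_injective.injOn,
      Finset.sum_congr rfl (g := w) fun t _ => by simp [hinv t]] at hsum
    obtain ⟨f, hf⟩ := hforce Q (by exact_mod_cast hQ) hsum
    refine ⟨fun v => if v = 0 then 0 else f (v - 1) + 1, fun e he => ?_⟩
    obtain ⟨e, heE, rfl⟩ := Finset.mem_image.1 he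
    obtain ⟨hinj, hmem⟩ := hf e heE
    constructor
    · intro u hu v hv huv
      rcases u with _ | u <;> rcases v with _ | v <;> simp at huv ⊢
      simp only [Hypergraph.suspend, Finset.coe_insert, Finset.coe_map] at hu hv
      exact hinj (by simpa using hu) (by simpa using hv) huv
    · refine Finset.mem_image.2 ⟨_, hmem, ?_⟩
      ext v
      rcases v with _ | v
      · simp [Hypergraph.suspend]
      · simp [Hypergraph.suspend]

/-- A nesting map for the suspension restricts to the old vertices: the value at the apex cannot
interfere, because the apex lies in every edge and the map is injective there. -/
theorem NotChainLike.suspend {E : Finset (Finset ℕ)} (hE : NotChainLike E) :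
    NotChainLike (E.image suspend) := by
  rintro ⟨c, hinj, hsub⟩
  have hmem : ∀ (e : Finset ℕ) (v : ℕ), v ∈ e → v + 1 ∈ Hypergraph.suspend e := fun e v hv => by
    simp [Hypergraph.suspend, hv]
  have hinj' : ∀ e ∈ E, Set.InjOn c (Hypergraph.suspend e) := fun e he =>
    hinj _ (Finset.mem_image_of_mem _ he)
  refine hE ⟨fun v => c (v + 1), fun e he u hu v hv huv => ?_, fun e he e' he' hcard => ?_⟩
  · exact Nat.succ_injective (hinj' e he (hmem e u hu) (hmem e v hv) huv)
  · intro y hy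
    obtain ⟨v, hv, rfl⟩ := Finset.mem_image.1 hy
    have h := hsub _ (Finset.mem_image_of_mem _ he) _ (Finset.mem_image_of_mem _ he')
      (by rw [card_suspend, card_suspend]; omega) (Finset.mem_image_of_mem c (hmem e v hv))
    obtain ⟨u, hu, huv⟩ := Finset.mem_image.1 h
    rcases u with _ | u
    · exfalso
      have h0 : ∀ e : Finset ℕ, 0 ∈ Hypergraph.suspend e := fun e => by simp [Hypergraph.suspend]
      have := hinj' e he (h0 e) (hmem e v hv) huv
      omega
    · exact Finset.mem_image.2 ⟨u, by simpa [Hypergraph.suspend] using hu, huv⟩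

theorem HasForcedFamily.image_succ {R : Finset ℕ} (h : HasForcedFamily R) :
    HasForcedFamily (R.image Nat.succ) := by
  obtain ⟨E, hER, hF, hE⟩ := h
  refine ⟨E.image suspend, ?_, hF.suspend, hE.suspend⟩
  rw [← hER, Finset.image_image, Finset.image_image]
  congr 1
  funext e
  exact card_suspend e

theorem HasForcedFamily.pair_add {a b : ℕ} (h : HasForcedFamily {a, b}) (k : ℕ) :
    HasForcedFamily {a + k, b + k} := by
  induction k with
  | zero => simpa using h
  | succ k ih => simpa [Finset.image_insert, Nat.succ_eq_add_one, add_assoc] using ih.image_succ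

/-! ### Three or more edge sizes. -/

/-- Three or more edge sizes: one edge of each size, the smallest not inside all others. -/
theorem hasForcedFamily_of_three_le_card (R : Finset ℕ) (hpos : ∀ r ∈ R, 0 < r)
    (hcard : 3 ≤ R.card) : HasForcedFamily R := by
  classical
  have hne : R.Nonempty := Finset.card_pos.1 (by omega)
  let a := R.min' hne
  let b := R.max' hne
  obtain ⟨d, hd⟩ : ((R.erase a).erase b).Nonempty := by
    rw [← Finset.card_pos]
    have h1 := Finset.pred_card_le_card_erase (s := R) (a := a)
    have h2 := Finset.pred_card_le_card_erase (s := R.erase a) (a := b)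
    omega
  have hdR : d ∈ R := Finset.mem_of_mem_erase (Finset.mem_of_mem_erase hd)
  have hdb : d ≠ b := Finset.ne_of_mem_erase hd
  have hda : d ≠ a := Finset.ne_of_mem_erase (Finset.mem_of_mem_erase hd)
  have had : a < d := lt_of_le_of_ne (R.min'_le d hdR) hda.symm
  have hdb' : d < b := lt_of_le_of_ne (R.le_max' d hdR) hdb
  have haR : a ∈ R := R.min'_mem hne
  have hbR : b ∈ R := R.max'_mem hne
  have ha0 : 0 < a := hpos a haR
  -- Initial segments, except that the smallest edge is pushed to the far end of the largest one. It
  -- then contains `b - 1`, which the middle edge `s d` lacks, while injectivity on `s b` forbids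
  -- identifying the two.
  let s : ℕ → Finset ℕ := fun r => if r = a then Finset.Ico (b - a) b else Finset.range r
  have hs : ∀ r, (s r).card = r := by
    intro r
    simp only [s]
    split_ifs with h
    · rw [Nat.card_Ico]; omega
    · exact Finset.card_range r
  have hsinj : Function.Injective s := fun r r' h => by rw [← hs r, ← hs r', h]
  have hcardE : (R.image s).card = R.card := Finset.card_image_of_injective _ hsinj
  refine ⟨R.image s, ?_, ⟨R.image s, fun _ => 1, ?_, ?_, ?_, ?_⟩, ?_⟩
  · rw [Finset.image_image]
    rw [show Finset.card ∘ s = id from funext hs, Finset.image_id]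
  · intro _ _
    exact zero_le_one
  · intro t ht
    obtain ⟨r, hr, rfl⟩ := Finset.mem_image.1 ht
    rwa [hs]
  · intro r hr
    have : (R.image s).filter (fun t => t.card = r) = {s r} := by
      ext t
      simp only [Finset.mem_filter, Finset.mem_image, Finset.mem_singleton]
      constructor
      · rintro ⟨⟨r', -, rfl⟩, h⟩
        rw [← h, hs]
      · rintro rfl
        exact ⟨⟨r, hr, rfl⟩, hs r⟩
    rw [this]
    simp
  · intro P hP hsum
    -- With unit weights, weight above `|R| - 1` means that nothing is missing.
    have hPE : P = R.image s := by
      refine Finset.eq_of_subset_of_card_le hP ?_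
      rw [Finset.sum_const, nsmul_eq_mul, mul_one, sub_lt_iff_lt_add] at hsum
      have : R.card < P.card + 1 := by exact_mod_cast hsum
      omega
    subst hPE
    exact ⟨id, fun e he => ⟨Function.injective_id.injOn, by simpa using he⟩⟩
  · rintro ⟨c, hinj, hsub⟩
    have hb := hinj _ (Finset.mem_image_of_mem s hbR)
    have h := hsub _ (Finset.mem_image_of_mem s haR) _ (Finset.mem_image_of_mem s hdR)
      (by rw [hs, hs]; exact had.le)
    have hsa : s a = Finset.Ico (b - a) b := if_pos rfl
    have hsd : s d = Finset.range d := if_neg hda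
    have hsb : s b = Finset.range b := if_neg (by omega)
    rw [hsb] at hb
    rw [hsa, hsd] at h
    have h1 : c (b - 1) ∈ (Finset.Ico (b - a) b).image c :=
      Finset.mem_image_of_mem c (Finset.mem_Ico.2 (by omega))
    obtain ⟨v, hv, hvc⟩ := Finset.mem_image.1 (h h1)
    rw [Finset.mem_range] at hv
    have := hb (Finset.mem_coe.2 (Finset.mem_range.2 (by omega)))
      (Finset.mem_coe.2 (Finset.mem_range.2 (by omega))) hvc
    omega

/-! ### Sizes `1` and `b`. -/

/-- The tight path with three edges of size `b`, together with its two end-vertices as edges. -/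
def loopedPath (b : ℕ) : Finset (Finset ℕ) :=
  {{0}, {b + 1}, Finset.Ico 0 b, Finset.Ico 1 (b + 1), Finset.Ico 2 (b + 2)}

/-- Consecutive path edges must have equal images, which forces period `b`, so `c (b + 1) = c 1`.
The two singletons force `c (b + 1) = c 0`, yet `0` and `1` share an edge. -/
theorem notChainLike_loopedPath {b : ℕ} (hb : 2 ≤ b) : NotChainLike (loopedPath b) := by
  rintro ⟨c, hinj, hsub⟩
  have m1 : {0} ∈ loopedPath b := by simp [loopedPath]
  have m2 : {b + 1} ∈ loopedPath b := by simp [loopedPath]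
  have m3 : Finset.Ico 0 b ∈ loopedPath b := by simp [loopedPath]
  have m4 : Finset.Ico 1 (b + 1) ∈ loopedPath b := by simp [loopedPath]
  have m5 : Finset.Ico 2 (b + 2) ∈ loopedPath b := by simp [loopedPath]
  have h01 : c (b + 1) = c 0 := by
    have := hsub _ m2 _ m1 (by simp)
    simpa using this
  -- shifting an edge by one adds a vertex with the image of the vertex that is lost
  have hshift : ∀ i, Finset.Ico i (i + b) ∈ loopedPath b →
      Finset.Ico (i + 1) (i + 1 + b) ∈ loopedPath b → c (i + b) = c i := by
    intro i h1 h2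
    have h := hsub _ h2 _ h1 (by simp)
    have hm : c (i + b) ∈ (Finset.Ico (i + 1) (i + 1 + b)).image c :=
      Finset.mem_image_of_mem c (Finset.mem_Ico.2 (by omega))
    obtain ⟨v, hv, hvc⟩ := Finset.mem_image.1 (h hm)
    rw [Finset.mem_Ico] at hv
    by_cases hvi : v = i
    · rw [← hvc, hvi]
    · have := hinj _ h2 (Finset.mem_coe.2 (Finset.mem_Ico.2 (by omega)))
        (Finset.mem_coe.2 (Finset.mem_Ico.2 (by omega))) hvc
      omega
  have e2 : c (b + 1) = c 1 := by
    have := hshift 1 (by rwa [add_comm 1 b]) (by rwa [show 1 + 1 + b = b + 2 by omega])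
    rwa [add_comm 1 b] at this
  have := hinj _ m3 (Finset.mem_coe.2 (Finset.mem_Ico.2 (by omega)))
    (Finset.mem_coe.2 (Finset.mem_Ico.2 (by omega))) (e2.symm.trans h01)
  omega

/-- A map into a `b`-set that has period `b` on the path sends all three `b`-edges onto it. -/
theorem loopedPath_hom_of_card_eq {b p x y : ℕ} (hb : 2 ≤ b) (hp : p < b + 1) (hx : x < b + 1)
    (hy : y < b + 1) (hxy : x ≠ y) (hxp : x ≠ p) (hyp : y ≠ p) (P : Finset (Finset ℕ))
    (h1 : {x} ∈ P) (h2 : {y} ∈ P) (h3 : (Finset.range (b + 1)).erase p ∈ P) :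
    ∃ f : ℕ → ℕ, ∀ e ∈ loopedPath b, Set.InjOn f e ∧ e.image f ∈ P := by
  classical
  have hcard : ((Finset.range (b + 1)).erase p).card = b := by
    rw [Finset.card_erase_of_mem (Finset.mem_range.2 hp), Finset.card_range, Nat.add_sub_cancel]
  let z : Fin b := ⟨0, by omega⟩
  let o : Fin b := ⟨1, by omega⟩
  have hzo : z ≠ o := by simp [z, o]
  -- The ends `0` and `b + 1` have residues `0` and `1` modulo `b`, which are sent to `x` and `y`.
  obtain ⟨g, hg⟩ := Finset.exists_equiv_extend_of_card_eq
    (t := (Finset.range (b + 1)).erase p) (by rw [hcard, Fintype.card_fin])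
    (s := {z, o}) (f := fun i : Fin b => if i = z then x else y)
    (by
      intro v hv
      simp only [Finset.mem_image, Finset.mem_insert, Finset.mem_singleton] at hv
      obtain ⟨i, -, rfl⟩ := hv
      split_ifs <;> simp [*])
    (by
      intro i hi j hj h
      simp only [Finset.coe_insert, Finset.coe_singleton, Set.mem_insert_iff,
        Set.mem_singleton_iff] at hi hj
      rcases hi with rfl | rfl <;> rcases hj with rfl | rfl
      · rfl
      · exact absurd (by simpa [hzo.symm] using h) hxy
      · exact absurd (by simpa [hzo.symm] using h.symm) hxy
      · rfl)
  have hgz : (g z : ℕ) = x := by simpa using hg z (by simp)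
  have hgo : (g o : ℕ) = y := by simpa [hzo.symm] using hg o (by simp)
  let f : ℕ → ℕ := fun i => g ⟨i % b, Nat.mod_lt _ (by omega)⟩
  have hf0 : f 0 = x := by
    have : (⟨0 % b, Nat.mod_lt _ (by omega)⟩ : Fin b) = z := Fin.ext (Nat.zero_mod b)
    rw [← hgz, ← this]
  have hf1 : f (b + 1) = y := by
    have : (⟨(b + 1) % b, Nat.mod_lt _ (by omega)⟩ : Fin b) = o := by
      refine Fin.ext ?_
      change (b + 1) % b = 1
      rw [Nat.add_mod_left, Nat.mod_eq_of_lt (by omega)]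
    rw [← hgo, ← this]
  have hinj : ∀ i, Set.InjOn f (Finset.Ico i (i + b) : Finset ℕ) := by
    intro i u hu v hv huv
    have h : u ≡ v [MOD b] := congrArg Fin.val (g.injective (Subtype.ext huv))
    rw [Finset.mem_coe, Finset.mem_Ico] at hu hv
    exact h.eq_of_abs_lt (by rw [abs_lt]; omega)
  have himg : ∀ i, (Finset.Ico i (i + b)).image f = (Finset.range (b + 1)).erase p := by
    intro i
    refine Finset.eq_of_subset_of_card_le ?_ ?_
    · intro v hv
      obtain ⟨u, -, rfl⟩ := Finset.mem_image.1 hv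
      exact (g _).2
    · rw [Finset.card_image_of_injOn (hinj i), Nat.card_Ico, hcard]
      omega
  refine ⟨f, fun e he => ?_⟩
  simp only [loopedPath, Finset.mem_insert, Finset.mem_singleton] at he
  have hpath : ∀ i, e = Finset.Ico i (i + b) → Set.InjOn f e ∧ e.image f ∈ P := by
    rintro i rfl
    exact ⟨hinj i, by rwa [himg]⟩
  rcases he with rfl | rfl | rfl | rfl | rfl
  · simpa [hf0] using h1
  · simpa [hf1] using h2
  · exact hpath 0 (by rw [zero_add])
  · exact hpath 1 (by rw [add_comm 1 b])
  · exact hpath 2 (by rw [add_comm 2 b])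

/-- A map of period `b + 1` onto a `(b + 1)`-set sends both ends of the path to the same vertex. -/
theorem loopedPath_hom_of_complete {b x : ℕ} (hx : x < b + 1) (P : Finset (Finset ℕ))
    (h1 : {x} ∈ P) (h3 : ∀ p < b + 1, (Finset.range (b + 1)).erase p ∈ P) :
    ∃ f : ℕ → ℕ, ∀ e ∈ loopedPath b, Set.InjOn f e ∧ e.image f ∈ P := by
  classical
  let f : ℕ → ℕ := fun i => (i + x) % (b + 1)
  have hf0 : f 0 = x := by simp [f, Nat.mod_eq_of_lt hx]
  have hf1 : f (b + 1) = x := by simp [f, Nat.mod_eq_of_lt hx]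
  have hinj : ∀ i, Set.InjOn f (Finset.Ico i (i + (b + 1)) : Finset ℕ) := by
    intro i u hu v hv huv
    have h : u ≡ v [MOD (b + 1)] := Nat.ModEq.add_right_cancel' x huv
    rw [Finset.mem_coe, Finset.mem_Ico] at hu hv
    exact h.eq_of_abs_lt (by rw [abs_lt]; omega)
  have himg' : ∀ i, (Finset.Ico i (i + (b + 1))).image f = Finset.range (b + 1) := by
    intro i
    refine Finset.eq_of_subset_of_card_le ?_ ?_
    · intro v hv
      obtain ⟨u, -, rfl⟩ := Finset.mem_image.1 hv
      exact Finset.mem_range.2 (Nat.mod_lt _ (Nat.succ_pos b))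
    · rw [Finset.card_image_of_injOn (hinj i), Nat.card_Ico, Finset.card_range]
      omega
  -- A window of length `b` misses exactly one residue modulo `b + 1`.
  have himg : ∀ i, (Finset.Ico i (i + b)).image f = (Finset.range (b + 1)).erase (f (i + b)) := by
    intro i
    have hsplit : Finset.Ico i (i + (b + 1)) = insert (i + b) (Finset.Ico i (i + b)) := by
      ext v
      simp only [Finset.mem_Ico, Finset.mem_insert]
      omega
    rw [← himg' i, hsplit, Finset.image_insert, Finset.erase_insert]
    intro h
    obtain ⟨v, hv, hvc⟩ := Finset.mem_image.1 h
    rw [Finset.mem_Ico] at hv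
    have := hinj i (Finset.mem_coe.2 (Finset.mem_Ico.2 (by omega)))
      (Finset.mem_coe.2 (Finset.mem_Ico.2 (by omega))) hvc
    omega
  refine ⟨f, fun e he => ?_⟩
  simp only [loopedPath, Finset.mem_insert, Finset.mem_singleton] at he
  have hpath : ∀ i, e = Finset.Ico i (i + b) → Set.InjOn f e ∧ e.image f ∈ P := by
    rintro i rfl
    refine ⟨(hinj i).mono ?_, ?_⟩
    · exact_mod_cast Finset.Ico_subset_Ico_right (by omega)
    · rw [himg]
      exact h3 _ (Nat.mod_lt _ (Nat.succ_pos b))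
  rcases he with rfl | rfl | rfl | rfl | rfl
  · simpa [hf0] using h1
  · simpa [hf1] using h1
  · exact hpath 0 (by rw [zero_add])
  · exact hpath 1 (by rw [add_comm 1 b])
  · exact hpath 2 (by rw [add_comm 2 b])

/-- If `L` and `M` are subsets of a set with `b + 1 ≥ 4` elements and `|L| + |M| > b + 1`, then
either some element of `M` is distinct from two elements of `L`, or `M` is everything. -/
theorem exists_of_card_add_card_gt {b : ℕ} (hb : 3 ≤ b) (L M : Finset ℕ)
    (hL : L ⊆ Finset.range (b + 1)) (hM : M ⊆ Finset.range (b + 1))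
    (h : b + 1 < L.card + M.card) :
    (∃ p ∈ M, ∃ x ∈ L, ∃ y ∈ L, x ≠ y ∧ x ≠ p ∧ y ≠ p) ∨
      (L.Nonempty ∧ M = Finset.range (b + 1)) := by
  classical
  have hLc := Finset.card_le_card hL
  have hMc := Finset.card_le_card hM
  rw [Finset.card_range] at hLc hMc
  have two : ∀ p ∈ M, 2 ≤ (L.erase p).card →
      ∃ p ∈ M, ∃ x ∈ L, ∃ y ∈ L, x ≠ y ∧ x ≠ p ∧ y ≠ p := by
    intro p hp hc
    obtain ⟨x, hx, y, hy, hxy⟩ := Finset.one_lt_card.1 hc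
    exact ⟨p, hp, x, Finset.mem_of_mem_erase hx, y, Finset.mem_of_mem_erase hy, hxy,
      Finset.ne_of_mem_erase hx, Finset.ne_of_mem_erase hy⟩
  by_cases h1 : L.card ≤ 1
  · right
    refine ⟨Finset.card_pos.1 (by omega), Finset.eq_of_subset_of_card_le hM ?_⟩
    rw [Finset.card_range]
    omega
  · left
    -- Here `|M| ≥ b ≥ 3`, so `M` has a point outside `L`. For `b = 2` the choice `L = M` with two
    -- elements would be a counterexample.
    by_cases h2 : L.card = 2
    · obtain ⟨p, hp⟩ : (M \ L).Nonempty := by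
        rw [← Finset.card_pos]
        have := Finset.le_card_sdiff L M
        omega
      rw [Finset.mem_sdiff] at hp
      refine two p hp.1 ?_
      rw [Finset.erase_eq_of_notMem hp.2]
      omega
    · obtain ⟨p, hp⟩ : M.Nonempty := Finset.card_pos.1 (by omega)
      refine two p hp ?_
      have := Finset.pred_card_le_card_erase (s := L) (a := p)
      omega

/-- The test sets are the singletons and the `b`-subsets of a `(b + 1)`-set, all of weight `1 / (b +
1)`. Encoding a `b`-subset by its omitted point turns a heavy pattern into two sets of points with
more than `b + 1` elements in total. -/
theorem hasForcedFamily_one {b : ℕ} (hb : 3 ≤ b) : HasForcedFamily {1, b} := by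
  classical
  have hR : ({1, b} : Finset ℕ).card = 2 := Finset.card_pair (by omega)
  let S : ℕ → Finset ℕ := fun i => {i}
  let C : ℕ → Finset ℕ := fun i => (Finset.range (b + 1)).erase i
  have hSinj : Function.Injective S := Finset.singleton_injective
  have hCcard : ∀ i ∈ Finset.range (b + 1), (C i).card = b := fun i hi => by
    rw [Finset.card_erase_of_mem hi, Finset.card_range, Nat.add_sub_cancel]
  have hCinj : Set.InjOn C (Finset.range (b + 1)) := by
    intro i hi j hj h
    by_contra hij
    have : i ∈ C j := Finset.mem_erase.2 ⟨hij, hi⟩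
    rw [← h] at this
    exact Finset.notMem_erase _ _ this
  let T₁ := (Finset.range (b + 1)).image S
  let T₂ := (Finset.range (b + 1)).image C
  have hT₁ : ∀ t ∈ T₁, t.card = 1 := by
    intro t ht
    obtain ⟨i, -, rfl⟩ := Finset.mem_image.1 ht
    exact Finset.card_singleton i
  have hT₂ : ∀ t ∈ T₂, t.card = b := by
    intro t ht
    obtain ⟨i, hi, rfl⟩ := Finset.mem_image.1 ht
    exact hCcard i hi
  have hcard₁ : T₁.card = b + 1 := by
    rw [Finset.card_image_of_injective _ hSinj, Finset.card_range]
  have hcard₂ : T₂.card = b + 1 := by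
    rw [Finset.card_image_of_injOn hCinj, Finset.card_range]
  have hb0 : (0 : ℝ) < b + 1 := by positivity
  refine ⟨loopedPath b, ?_, ⟨T₁ ∪ T₂, fun _ => 1 / ((b : ℝ) + 1), fun _ _ => by positivity,
    ?_, ?_, ?_⟩, notChainLike_loopedPath (by omega)⟩
  · simp [loopedPath, Finset.image_insert]
  · intro t ht
    rcases Finset.mem_union.1 ht with h | h
    · simp [hT₁ t h]
    · simp [hT₂ t h]
  · intro r hr
    have hfilter : ∀ T : Finset (Finset ℕ), T.card = b + 1 →
        (T₁ ∪ T₂).filter (fun t => t.card = r) = T →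
        ∑ t ∈ T₁ ∪ T₂ with t.card = r, 1 / ((b : ℝ) + 1) = 1 := by
      intro T hT h
      rw [h, Finset.sum_const, hT, nsmul_eq_mul]
      push_cast
      field_simp
    simp only [Finset.mem_insert, Finset.mem_singleton] at hr
    rcases hr with rfl | rfl
    · refine hfilter T₁ hcard₁ ?_
      rw [Finset.filter_union, Finset.filter_true_of_mem hT₁, Finset.filter_false_of_mem,
        Finset.union_empty]
      intro t ht
      rw [hT₂ t ht]
      omega
    · refine hfilter T₂ hcard₂ ?_
      rw [Finset.filter_union, Finset.filter_true_of_mem hT₂, Finset.filter_false_of_mem,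
        Finset.empty_union]
      intro t ht
      rw [hT₁ t ht]
      omega
  · intro P hP hsum
    rw [hR, Finset.sum_const, nsmul_eq_mul, mul_one_div, lt_div_iff₀ hb0] at hsum
    let L := (Finset.range (b + 1)).filter fun i => S i ∈ P
    let M := (Finset.range (b + 1)).filter fun i => C i ∈ P
    have hPsub : P ⊆ L.image S ∪ M.image C := by
      intro t ht
      rcases Finset.mem_union.1 (hP ht) with h | h
      · obtain ⟨i, hi, rfl⟩ := Finset.mem_image.1 h
        exact Finset.mem_union_left _ (Finset.mem_image_of_mem _ (Finset.mem_filter.2 ⟨hi, ht⟩))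
      · obtain ⟨i, hi, rfl⟩ := Finset.mem_image.1 h
        exact Finset.mem_union_right _ (Finset.mem_image_of_mem _ (Finset.mem_filter.2 ⟨hi, ht⟩))
    have hPcard : P.card ≤ L.card + M.card :=
      (Finset.card_le_card hPsub).trans ((Finset.card_union_le _ _).trans
        (add_le_add Finset.card_image_le Finset.card_image_le))
    have hlarge : b + 1 < P.card := by
      have : ((b : ℝ) + 1) < P.card := by
        push_cast at hsum
        linarith
      exact_mod_cast this
    rcases exists_of_card_add_card_gt hb L M (Finset.filter_subset _ _) (Finset.filter_subset _ _)
      (by omega) with ⟨p, hp, x, hx, y, hy, hxy, hxp, hyp⟩ | ⟨⟨x, hx⟩, hM⟩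
    · rw [Finset.mem_filter, Finset.mem_range] at hp hx hy
      exact loopedPath_hom_of_card_eq (by omega) hp.1 hx.1 hy.1 hxy hxp hyp P hx.2 hy.2 hp.2
    · rw [Finset.mem_filter, Finset.mem_range] at hx
      refine loopedPath_hom_of_complete hx.1 P hx.2 fun p hp => ?_
      have : p ∈ M := by rw [hM]; exact Finset.mem_range.2 hp
      exact (Finset.mem_filter.1 this).2

/-! ### Sizes `2` and `3`. -/

/-- Five triples, three of them forming a tight path, and two pairs. -/
def pairedPath : Finset (Finset ℕ) :=
  {{5, 0}, {5, 4}, {0, 1, 2}, {1, 2, 3}, {2, 3, 4}, {5, 0, 6}, {5, 4, 7}}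

/-- The path forces `c 4 = c 1`, and the two pairs force `c 0 = c 4`, but `0` and `1` share a
triple. -/
theorem notChainLike_pairedPath : NotChainLike pairedPath := by
  rintro ⟨c, hinj, hsub⟩
  have i1 := hinj {0, 1, 2} (by decide)
  have i2 := hinj {1, 2, 3} (by decide)
  have i3 := hinj {2, 3, 4} (by decide)
  have i4 := hinj {5, 0, 6} (by decide)
  have h1 := hsub {1, 2, 3} (by decide) {0, 1, 2} (by decide) (by decide)
  have h2 := hsub {2, 3, 4} (by decide) {1, 2, 3} (by decide) (by decide)
  have h3 := hsub {5, 0} (by decide) {5, 4} (by decide) (by decide)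
  have n01 : c 0 ≠ c 1 := fun h => by simpa using i1 (by simp) (by simp) h
  have n31 : c 3 ≠ c 1 := fun h => by simpa using i2 (by simp) (by simp) h
  have n32 : c 3 ≠ c 2 := fun h => by simpa using i2 (by simp) (by simp) h
  have n42 : c 4 ≠ c 2 := fun h => by simpa using i3 (by simp) (by simp) h
  have n43 : c 4 ≠ c 3 := fun h => by simpa using i3 (by simp) (by simp) h
  have n05 : c 0 ≠ c 5 := fun h => by simpa using i4 (by simp) (by simp) h
  have m1 : c 4 ∈ ({1, 2, 3} : Finset ℕ).image c := h2 (by simp)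
  have m2 : c 0 ∈ ({5, 4} : Finset ℕ).image c := h3 (by simp)
  simp only [Finset.image_insert, Finset.image_singleton, Finset.mem_insert,
    Finset.mem_singleton] at m1 m2
  omega

/-- A triple containing two pairs is a homomorphic image. -/
theorem pairedPath_hom_of_triple {i j k : ℕ} (hij : i ≠ j) (hik : i ≠ k) (hjk : j ≠ k)
    (P : Finset (Finset ℕ)) (h : {i, j, k} ∈ P ∧ {i, j} ∈ P ∧ {i, k} ∈ P) :
    ∃ f : ℕ → ℕ, ∀ e ∈ pairedPath, Set.InjOn f e ∧ e.image f ∈ P := by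
  classical
  have e1 : ({j, k, i} : Finset ℕ) = {i, j, k} := by ext; simp; tauto
  have e2 : ({k, i, j} : Finset ℕ) = {i, j, k} := by ext; simp; tauto
  have e3 : ({i, k, j} : Finset ℕ) = {i, j, k} := by ext; simp; tauto
  -- The path `0, …, 4` winds around the triple with period three, and `5` goes to the common point
  -- `i` of the two pairs.
  refine ⟨fun v => if v ∈ ({0, 3, 7} : Finset ℕ) then j else if v ∈ ({2, 5} : Finset ℕ) then i
    else k, fun e he => ?_⟩
  rw [← Finset.card_image_iff]
  simp only [pairedPath, Finset.mem_insert, Finset.mem_singleton] at he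
  rcases he with rfl | rfl | rfl | rfl | rfl | rfl | rfl <;>
    simp [Finset.image_insert, e1, e2, e3, h, hij, hik, hjk]

/-- Three triples through a common vertex `d`, together with a pair avoiding `d`, form a
homomorphic image. -/
theorem pairedPath_hom_of_star {a b c d : ℕ} (hab : a ≠ b) (hac : a ≠ c) (had : a ≠ d)
    (hbc : b ≠ c) (hbd : b ≠ d) (hcd : c ≠ d) (P : Finset (Finset ℕ))
    (h : {a, b, d} ∈ P ∧ {b, c, d} ∈ P ∧ {a, c, d} ∈ P ∧ {a, b} ∈ P) :
    ∃ f : ℕ → ℕ, ∀ e ∈ pairedPath, Set.InjOn f e ∧ e.image f ∈ P := by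
  classical
  have e1 : ({b, d, c} : Finset ℕ) = {b, c, d} := by ext; simp; tauto
  have e2 : ({d, c, a} : Finset ℕ) = {a, c, d} := by ext; simp; tauto
  have e3 : ({b, a, d} : Finset ℕ) = {a, b, d} := by ext; simp; tauto
  have e4 : ({b, a} : Finset ℕ) = {a, b} := Finset.pair_comm _ _
  -- Both ends of the path go to `a`, so the two pairs collapse to `{a, b}`.
  refine ⟨fun v => if v ∈ ({0, 4} : Finset ℕ) then a else if v ∈ ({1, 5} : Finset ℕ) then b
    else if v = 3 then c else d, fun e he => ?_⟩
  rw [← Finset.card_image_iff]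
  simp only [pairedPath, Finset.mem_insert, Finset.mem_singleton] at he
  rcases he with rfl | rfl | rfl | rfl | rfl | rfl | rfl <;>
    simp [Finset.image_insert, e1, e2, e3, e4, h, hab, hac, had, hbc, hbd, hcd]

/-- The pairs and triples of a four-element set. -/
def pairsAndTriples : Finset (Finset ℕ) :=
  {{0, 1}, {0, 2}, {0, 3}, {1, 2}, {1, 3}, {2, 3},
    {0, 1, 2}, {0, 1, 3}, {0, 2, 3}, {1, 2, 3}}

theorem hasForcedFamily_two_three : HasForcedFamily {2, 3} := by
  classical
  refine ⟨pairedPath, by decide, ⟨pairsAndTriples,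
    fun t => if t.card = 2 then 1 / 6 else 1 / 4, ?_, by decide, ?_, ?_⟩, notChainLike_pairedPath⟩
  · intro t _
    dsimp only
    split_ifs <;> norm_num
  · intro r hr
    simp only [Finset.mem_insert, Finset.mem_singleton] at hr
    rcases hr with rfl | rfl
    · rw [Finset.sum_congr rfl (g := fun _ => (1 / 6 : ℝ)) fun t ht =>
        if_pos (Finset.mem_filter.1 ht).2, Finset.sum_const,
        show (pairsAndTriples.filter fun t => t.card = 2).card = 6 by decide]
      norm_num
    · rw [Finset.sum_congr rfl (g := fun _ => (1 / 4 : ℝ)) fun t ht =>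
        if_neg (by rw [(Finset.mem_filter.1 ht).2]; decide), Finset.sum_const,
        show (pairsAndTriples.filter fun t => t.card = 3).card = 4 by decide]
      norm_num
  intro P hP hsum
  by_contra hno
  let ι : Finset ℕ → ℕ := fun t => if t ∈ P then 1 else 0
  have hle : ∀ t, ι t ≤ 1 := fun t => by
    simp only [ι]
    split_ifs <;> omega
  have hmem : ∀ t, 1 ≤ ι t → t ∈ P := fun t h => by
    by_contra ht
    simp [ι, ht] at h
  have htriple : ∀ i j k : ℕ, i ≠ j → i ≠ k → j ≠ k → ∀ s e e' : Finset ℕ, s = {i, j, k} →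
      e = {i, j} → e' = {i, k} → ι s + ι e + ι e' ≤ 2 := by
    rintro i j k hij hik hjk s e e' rfl rfl rfl
    by_contra! h
    have h1 := hle {i, j, k}
    have h2 := hle {i, j}
    have h3 := hle {i, k}
    exact hno (pairedPath_hom_of_triple hij hik hjk P
      ⟨hmem _ (by omega), hmem _ (by omega), hmem _ (by omega)⟩)
  have hstar : ∀ a b c d : ℕ, (a ≠ b ∧ a ≠ c ∧ a ≠ d ∧ b ≠ c ∧ b ≠ d ∧ c ≠ d) →
      ∀ s s' s'' e : Finset ℕ, s = {a, b, d} → s' = {b, c, d} → s'' = {a, c, d} → e = {a, b} →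
      ι s + ι s' + ι s'' + ι e ≤ 3 := by
    rintro a b c d ⟨hab, hac, had, hbc, hbd, hcd⟩ s s' s'' e rfl rfl rfl rfl
    by_contra! h
    have h1 := hle {a, b, d}
    have h2 := hle {b, c, d}
    have h3 := hle {a, c, d}
    have h4 := hle {a, b}
    exact hno (pairedPath_hom_of_star hab hac had hbc hbd hcd P
      ⟨hmem _ (by omega), hmem _ (by omega), hmem _ (by omega), hmem _ (by omega)⟩)
  -- The weights `1 / 6` and `1 / 4` are scaled by `12` to make the count integral.
  have hweight : 12 < ∑ t ∈ pairsAndTriples, (if t.card = 2 then 2 else 3) * ι t := by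
    have h1 : ∑ t ∈ P, (if t.card = 2 then (1 / 6 : ℝ) else 1 / 4) =
        (∑ t ∈ pairsAndTriples, (if t.card = 2 then 2 else 3) * ι t : ℕ) / 12 := by
      rw [← Finset.inter_eq_right.2 hP, ← Finset.sum_ite_mem]
      push_cast
      rw [Finset.sum_div]
      refine Finset.sum_congr rfl fun t _ => ?_
      simp only [ι]
      split_ifs <;> norm_num
    rw [h1, show ({2, 3} : Finset ℕ).card = 2 from rfl] at hsum
    have h2 : (12 : ℝ) < (∑ t ∈ pairsAndTriples, (if t.card = 2 then 2 else 3) * ι t : ℕ) := by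
      push_cast at hsum ⊢
      linarith
    exact_mod_cast h2
  have hexpand : ∑ t ∈ pairsAndTriples, (if t.card = 2 then 2 else 3) * ι t =
      2 * (ι {0, 1} + ι {0, 2} + ι {0, 3} + ι {1, 2} + ι {1, 3} + ι {2, 3}) +
        3 * (ι {0, 1, 2} + ι {0, 1, 3} + ι {0, 2, 3} + ι {1, 2, 3}) := by
    rw [pairsAndTriples]
    repeat rw [Finset.sum_insert (by decide)]
    rw [Finset.sum_singleton]
    simp
    ring
  rw [hexpand] at hweight
  -- A linear form of the triple condition: at most three pairs when `s` is absent, at most one when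
  -- it is present.
  have htri : ∀ i j k : ℕ, i ≠ j → i ≠ k → j ≠ k → ∀ s e e' e'' : Finset ℕ, s = {i, j, k} →
      e = {i, j} → e' = {i, k} → e'' = {j, k} → ι e + ι e' + ι e'' + 2 * ι s ≤ 3 := by
    intro i j k hij hik hjk s e e' e'' hs he he' he''
    have h1 := htriple i j k hij hik hjk s e e' hs he he'
    have h2 := htriple j i k hij.symm hjk hik s e e'' (by rw [hs, Finset.insert_comm])
      (by rw [he, Finset.pair_comm]) he''
    have h3 := htriple k i j hik.symm hjk.symm hij s e' e''
      (by rw [hs, Finset.insert_comm k i, Finset.pair_comm k j])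
      (by rw [he', Finset.pair_comm]) (by rw [he'', Finset.pair_comm])
    have := hle s
    have := hle e
    have := hle e'
    have := hle e''
    omega
  have t012 := htri 0 1 2 (by decide) (by decide) (by decide) {0, 1, 2} {0, 1} {0, 2} {1, 2}
    (by decide) (by decide) (by decide) (by decide)
  have t013 := htri 0 1 3 (by decide) (by decide) (by decide) {0, 1, 3} {0, 1} {0, 3} {1, 3}
    (by decide) (by decide) (by decide) (by decide)
  have t023 := htri 0 2 3 (by decide) (by decide) (by decide) {0, 2, 3} {0, 2} {0, 3} {2, 3}
    (by decide) (by decide) (by decide) (by decide)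
  have t123 := htri 1 2 3 (by decide) (by decide) (by decide) {1, 2, 3} {1, 2} {1, 3} {2, 3}
    (by decide) (by decide) (by decide) (by decide)
  have s023 := hstar 2 3 1 0 (by decide) {0, 2, 3} {0, 1, 3} {0, 1, 2} {2, 3}
    (by decide) (by decide) (by decide) (by decide)
  have s013 := hstar 1 3 2 0 (by decide) {0, 1, 3} {0, 2, 3} {0, 1, 2} {1, 3}
    (by decide) (by decide) (by decide) (by decide)
  have s012 := hstar 1 2 3 0 (by decide) {0, 1, 2} {0, 2, 3} {0, 1, 3} {1, 2}
    (by decide) (by decide) (by decide) (by decide)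
  have s123 := hstar 2 3 0 1 (by decide) {1, 2, 3} {0, 1, 3} {0, 1, 2} {2, 3}
    (by decide) (by decide) (by decide) (by decide)
  have s103 := hstar 0 3 2 1 (by decide) {0, 1, 3} {1, 2, 3} {0, 1, 2} {0, 3}
    (by decide) (by decide) (by decide) (by decide)
  have s102 := hstar 0 2 3 1 (by decide) {0, 1, 2} {1, 2, 3} {0, 1, 3} {0, 2}
    (by decide) (by decide) (by decide) (by decide)
  have s213 := hstar 1 3 0 2 (by decide) {1, 2, 3} {0, 2, 3} {0, 1, 2} {1, 3}
    (by decide) (by decide) (by decide) (by decide)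
  have s203 := hstar 0 3 1 2 (by decide) {0, 2, 3} {1, 2, 3} {0, 1, 2} {0, 3}
    (by decide) (by decide) (by decide) (by decide)
  have s201 := hstar 0 1 3 2 (by decide) {0, 1, 2} {1, 2, 3} {0, 2, 3} {0, 1}
    (by decide) (by decide) (by decide) (by decide)
  have s312 := hstar 1 2 0 3 (by decide) {1, 2, 3} {0, 2, 3} {0, 1, 3} {1, 2}
    (by decide) (by decide) (by decide) (by decide)
  have s302 := hstar 0 2 1 3 (by decide) {0, 2, 3} {1, 2, 3} {0, 1, 3} {0, 2}
    (by decide) (by decide) (by decide) (by decide)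
  have s301 := hstar 0 1 2 3 (by decide) {0, 1, 3} {1, 2, 3} {0, 2, 3} {0, 1}
    (by decide) (by decide) (by decide) (by decide)
  have b0 := hle {0, 1}
  have b1 := hle {0, 2}
  have b2 := hle {0, 3}
  have b3 := hle {1, 2}
  have b4 := hle {1, 3}
  have b5 := hle {2, 3}
  rcases Nat.le_one_iff_eq_zero_or_eq_one.1 (hle {0, 1, 2}) with h0 | h0 <;>
  rcases Nat.le_one_iff_eq_zero_or_eq_one.1 (hle {0, 1, 3}) with h1 | h1 <;>
  rcases Nat.le_one_iff_eq_zero_or_eq_one.1 (hle {0, 2, 3}) with h2 | h2 <;>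
  rcases Nat.le_one_iff_eq_zero_or_eq_one.1 (hle {1, 2, 3}) with h3 | h3 <;>
  simp only [h0, h1, h2, h3] at * <;> clear htri hstar htriple hmem hle hexpand <;> linarith

/-- Two sizes with gap at least two descend to `{1, b - a + 1}` by undoing suspensions. Consecutive
sizes descend only to `{2, 3}`, which is why `{1, 2}` is left out. -/
theorem hasForcedFamily (R : Finset ℕ) (hpos : ∀ r ∈ R, 0 < r) (hcard : 2 ≤ R.card)
    (hne : R ≠ {1, 2}) : HasForcedFamily R := by
  rcases hcard.lt_or_eq with h | h
  · exact hasForcedFamily_of_three_le_card R hpos h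
  obtain ⟨a, b, hab, rfl⟩ : ∃ a b, a < b ∧ R = {a, b} := by
    obtain ⟨a, b, hab, rfl⟩ := Finset.card_eq_two.1 h.symm
    rcases lt_or_gt_of_ne hab with h | h
    · exact ⟨a, b, h, rfl⟩
    · exact ⟨b, a, h, Finset.pair_comm a b⟩
  have ha : 0 < a := hpos a (by simp)
  by_cases hb : b = a + 1
  · have ha2 : 2 ≤ a := by
      by_contra
      obtain rfl : a = 1 := by omega
      exact hne (by rw [hb])
    have := hasForcedFamily_two_three.pair_add (a - 2)
    rwa [show 2 + (a - 2) = a by omega, show 3 + (a - 2) = b by omega] at this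
  · have := (hasForcedFamily_one (b := b - a + 1) (by omega)).pair_add (a - 1)
    rwa [show 1 + (a - 1) = a by omega, show b - a + 1 + (a - 1) = b by omega] at this

end Hypergraph

theorem mainTheorem2 (R : Finset ℕ) (hpos : ∀ r ∈ R, 0 < r) (hcard : 2 ≤ R.card)
    (hne : R ≠ {1, 2}) :
    ∃ H : Hypergraph ℕ, H.vertexSet.Finite ∧ H.edgeTypes = (R : Set ℕ) ∧ H.IsDegenerate ∧
      ¬ H.IsContainedInBlowUpOfChain R := by
  obtain ⟨E, hER, hF, hE⟩ := Hypergraph.hasForcedFamily R hpos hcard hne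
  exact ⟨Hypergraph.ofEdges E, Hypergraph.finite_vertexSet_ofEdges E,
    by rw [Hypergraph.edgeTypes_ofEdges, hER],
    Hypergraph.isDegenerate_of_forces R E (Finset.card_pos.1 (by omega)) hER hF,
    hE.not_isContainedInBlowUpOfChain R⟩
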